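/- Let $M$ be a smooth manifold of dimension $n\ge 3$ and let $G$ be a spray on $M$, i.e. a vector field on $TM$ which in every standard local coordinate system $(x^i,y^i)$ of $TM$ has the form $G=y^i\frac{\partial}{\partial x^i}-2G^i\frac{\partial}{\partial y^i}$, where the $G^i=G^i(x,y)$ are $C^\infty$ at $y\neq 0$ and $G^i(x,\lambda y)=\lambda^2G^i(x,y)$ for $\lambda>0$. Put $N^i_j=\frac{\partial G^i}{\partial y^j}$, $\Gamma^i_{jk}=\frac{\partial^2G^i}{\partial y^j\partial y^k}$, $\frac{\delta}{\delta x^k}=\frac{\partial}{\partial x^k}-N^m_k\frac{\partial}{\partial y^m}$, $$R^{\ i}_{j\ kl}=\frac{\delta\Gamma^i_{jl}}{\delta x^k}-\frac{\delta\Gamma^i_{jk}}{\delta x^l}+\Gamma^i_{ks}\Gamma^s_{jl}-\Gamma^s_{jk}\Gamma^i_{ls},\qquad R^i_{\ k}=y^jR^{\ i}_{j\ kl}y^l,\qquad R=\frac{1}{n-1}R^m_{\ m}.$$ For a function $f$ write $f_{\cdot k}=\frac{\partial f}{\partial y^k}$ and $f_{|k}=\frac{\delta f}{\delta x^k}$,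 and put $f_{\cdot l|m}=\frac{\delta f_{\cdot l}}{\delta x^m}-\Gamma^s_{lm}f_{\cdot s}$. The spray $G$ is said to be of isotropic curvature if $R^i_{\ k}=R\,\delta^i_{\ k}-\frac12R_{\cdot k}y^i$ (at all $y\ne0$, in all standard local coordinates). Theorem. Suppose that $G$ is of isotropic curvature. Then, at all $y\neq0$ and in all standard local coordinates, $$\eta_l:=\tfrac12R_{\cdot l|m}y^m-R_{|l}=0 .$$ Consequently, if $R$ is a Finsler metric, i.e. $R=\tilde F^2$ on $TM\setminus 0$ for some Finsler metric $\tilde F$ on $M$ (a function on $TM$ which is positive and smooth on $TM\setminus0$, positively homogeneous of degree one, with positive definite $\tilde g_{ij}=\frac12[\tilde F^2]_{\cdot i\cdot j}$), then $R$ is dually equivalent to $G$: with $L=R=\tilde F^2$, the spray coefficients $\tilde G^i=\frac14\tilde g^{il}\{L_{x^ky^l}y^k-L_{x^l}\}$ of $\tilde F$ satisfy $$\tilde G^i=G^i+\tfrac14\,\tilde g^{ik}L_{|k}.$$ -/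

import Mathlib

open scoped Manifold ContDiff

noncomputable section

namespace SprayGeometry

/-! ### Calculus in standard coordinates `(x, y)` of a tangent bundle -/

/-- The coordinate space `ℝⁿ × ℝⁿ`; a point `p` has position `p.1 = x` and velocity `p.2 = y`. -/
abbrev XY (n : ℕ) : Type := EuclideanSpace ℝ (Fin n) × EuclideanSpace ℝ (Fin n)

/-- `∂f/∂x^k`. -/
def dx {n : ℕ} (k : Fin n) (f : XY n → ℝ) (p : XY n) : ℝ :=
  fderiv ℝ f p (EuclideanSpace.single k 1, 0)

/-- `∂f/∂y^k`, the vertical derivative `f_{·k}`. -/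
def dy {n : ℕ} (k : Fin n) (f : XY n → ℝ) (p : XY n) : ℝ :=
  fderiv ℝ f p (0, EuclideanSpace.single k 1)

/-- The nonlinear connection `N^i_j = ∂G^i/∂y^j` of the spray coefficients `G^i`. -/
def connN {n : ℕ} (G : Fin n → XY n → ℝ) (i j : Fin n) : XY n → ℝ :=
  dy j (G i)

/-- The Berwald connection coefficients `Γ^i_{jk} = ∂²G^i/∂y^j∂y^k`. -/
def connΓ {n : ℕ} (G : Fin n → XY n → ℝ) (i j k : Fin n) : XY n → ℝ :=
  dy j (dy k (G i))

/-- `δf/δx^k = ∂f/∂x^k - N^m_k ∂f/∂y^m`, which is also the horizontal covariant derivative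
`f_{|k}` of a scalar function `f`. -/
def hd {n : ℕ} (G : Fin n → XY n → ℝ) (k : Fin n) (f : XY n → ℝ) (p : XY n) : ℝ :=
  dx k f p - ∑ m, connN G m k p * dy m f p

/-- The horizontal covariant derivative `θ_{l|m} = δθ_l/δx^m - Γ^s_{lm} θ_s` of a covector
`θ = (θ_l)` with respect to the Berwald connection. -/
def hdCovector {n : ℕ} (G : Fin n → XY n → ℝ) (θ : Fin n → XY n → ℝ) (l m : Fin n)
    (p : XY n) : ℝ :=
  hd G m (θ l) p - ∑ s, connΓ G s l m p * θ s p

/-- The Riemann curvature tensor `R_j^i_{kl}` of the Berwald connection; the arguments are in the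
order `j i k l`. -/
def riem4 {n : ℕ} (G : Fin n → XY n → ℝ) (j i k l : Fin n) (p : XY n) : ℝ :=
  hd G k (connΓ G i j l) p - hd G l (connΓ G i j k) p
    + ∑ s, connΓ G i k s p * connΓ G s j l p - ∑ s, connΓ G s j k p * connΓ G i l s p

/-- The two-index Riemann curvature `R^i_k = y^j R_j^i_{kl} y^l`. -/
def riem2 {n : ℕ} (G : Fin n → XY n → ℝ) (i k : Fin n) (p : XY n) : ℝ :=
  ∑ j, ∑ l, p.2 j * riem4 G j i k l p * p.2 l

/-- `R = (1/(n-1)) R^m_m`. -/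
def scalR {n : ℕ} (G : Fin n → XY n → ℝ) (p : XY n) : ℝ :=
  1 / ((n : ℝ) - 1) * ∑ m, riem2 G m m p

/-- `T^i_k = R^i_k - (R δ^i_k - ½ R_{·k} y^i)`. -/
def tensorT {n : ℕ} (G : Fin n → XY n → ℝ) (i k : Fin n) (p : XY n) : ℝ :=
  riem2 G i k p - (scalR G p * (if i = k then 1 else 0) - 1 / 2 * dy k (scalR G) p * p.2 i)

/-- `η_l = ½ R_{·l|m} y^m - R_{|l}`. -/
def etaForm {n : ℕ} (G : Fin n → XY n → ℝ) (l : Fin n) (p : XY n) : ℝ :=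
  1 / 2 * ∑ m, hdCovector G (fun s => dy s (scalR G)) l m p * p.2 m - hd G l (scalR G) p

/-- The fundamental tensor `g_{ij} = ½ L_{·i·j}` of a function `L`. -/
def fundTensor {n : ℕ} (L : XY n → ℝ) (p : XY n) : Matrix (Fin n) (Fin n) ℝ :=
  Matrix.of fun i j => 1 / 2 * dy i (dy j L) p

/-- The spray (geodesic) coefficients `¼ g^{il} (L_{x^k y^l} y^k - L_{x^l})` of `L = F²`. -/
def finslerCoeff {n : ℕ} (L : XY n → ℝ) (i : Fin n) (p : XY n) : ℝ :=
  1 / 4 * ∑ l, (fundTensor L p)⁻¹ i l * (∑ k, dx k (dy l L) p * p.2 k - dx l L p)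

/-! ### Standard coordinates on the tangent bundle of a manifold -/

section Manifold

variable {n : ℕ} {M : Type*} [TopologicalSpace M] [ChartedSpace (EuclideanSpace ℝ (Fin n)) M]

/-- The standard coordinates `v ↦ (x, y) = (φ (π v), dφ v)` on `TM` induced by a chart `φ`. -/
def coords (φ : OpenPartialHomeomorph M (EuclideanSpace ℝ (Fin n)))
    (v : TangentBundle (𝓡 n) M) : XY n :=
  (φ v.proj, mfderiv (𝓡 n) (𝓡 n) φ v.proj v.snd)

/-- The tangent vector with standard coordinates `(x, y)`, for `x` in the range of `φ`. -/
def ofCoords (φ : OpenPartialHomeomorph M (EuclideanSpace ℝ (Fin n)))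
    (p : XY n) : TangentBundle (𝓡 n) M :=
  ⟨φ.symm p.1, mfderiv (𝓡 n) (𝓡 n) φ.symm p.1 p.2⟩

/-- The range of the standard coordinates on the slit tangent bundle `TM \ 0`. -/
def slit (φ : OpenPartialHomeomorph M (EuclideanSpace ℝ (Fin n))) : Set (XY n) :=
  {p | p.1 ∈ φ.target ∧ p.2 ≠ 0}

variable [IsManifold (𝓡 n) ∞ M]

/-- The components `(a, b)` in standard coordinates, `a^i ∂/∂x^i + b^i ∂/∂y^i`, of a vector field
on `TM` at the point with coordinates `p`. -/
def components (X : (v : TangentBundle (𝓡 n) M) → TangentSpace (𝓡 n).tangent v)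
    (φ : OpenPartialHomeomorph M (EuclideanSpace ℝ (Fin n))) (p : XY n) : XY n :=
  mfderiv (𝓡 n).tangent 𝓘(ℝ, XY n) (coords φ) (ofCoords φ p) (X (ofCoords φ p))

end Manifold

/-- A spray on `M`: a vector field on `TM` which in all standard local coordinates has the form
`y^i ∂/∂x^i - 2 G^i ∂/∂y^i`, where the `G^i` are smooth on nonzero vectors and positively
homogeneous of degree two in `y`. -/
structure Spray (n : ℕ) (M : Type*) [TopologicalSpace M]
    [ChartedSpace (EuclideanSpace ℝ (Fin n)) M] [IsManifold (𝓡 n) ∞ M] where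
  /-- The vector field on `TM`. -/
  field : (v : TangentBundle (𝓡 n) M) → TangentSpace (𝓡 n).tangent v
  fst_components : ∀ φ ∈ IsManifold.maximalAtlas (𝓡 n) ∞ M, ∀ x ∈ φ.target,
    ∀ y : EuclideanSpace ℝ (Fin n), (components field φ (x, y)).1 = y
  smooth : ∀ φ ∈ IsManifold.maximalAtlas (𝓡 n) ∞ M,
    ContDiffOn ℝ ∞ (fun p => (components field φ p).2) (slit φ)
  homogeneous : ∀ φ ∈ IsManifold.maximalAtlas (𝓡 n) ∞ M, ∀ x ∈ φ.target,
    ∀ y : EuclideanSpace ℝ (Fin n), ∀ c : ℝ, 0 < c →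
      (components field φ (x, c • y)).2 = c ^ 2 • (components field φ (x, y)).2

/-- The function `F²` of `(x, y)` in the standard coordinates induced by `φ`. -/
def localSq {n : ℕ} {M : Type*} [TopologicalSpace M]
    [ChartedSpace (EuclideanSpace ℝ (Fin n)) M] [IsManifold (𝓡 n) ∞ M]
    (F : TangentBundle (𝓡 n) M → ℝ)
    (φ : OpenPartialHomeomorph M (EuclideanSpace ℝ (Fin n))) (p : XY n) : ℝ :=
  F (ofCoords φ p) ^ 2

/-- A Finsler metric on `M`. -/
structure FinslerMetric (n : ℕ) (M : Type*) [TopologicalSpace M]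
    [ChartedSpace (EuclideanSpace ℝ (Fin n)) M] [IsManifold (𝓡 n) ∞ M] where
  /-- The norm function on `TM`. -/
  norm : TangentBundle (𝓡 n) M → ℝ
  smooth : ContMDiffOn (𝓡 n).tangent 𝓘(ℝ, ℝ) ∞ norm {v | v.snd ≠ 0}
  pos : ∀ v : TangentBundle (𝓡 n) M, v.snd ≠ 0 → 0 < norm v
  homogeneous : ∀ (x : M) (v : TangentSpace (𝓡 n) x) (c : ℝ), 0 ≤ c →
    norm ⟨x, c • v⟩ = c * norm ⟨x, v⟩
  posDef : ∀ φ ∈ IsManifold.maximalAtlas (𝓡 n) ∞ M, ∀ p ∈ slit φ,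
    (fundTensor (localSq norm φ) p).PosDef

section Curvature

variable {n : ℕ} {M : Type*} [TopologicalSpace M] [ChartedSpace (EuclideanSpace ℝ (Fin n)) M]
  [IsManifold (𝓡 n) ∞ M]

/-- The spray coefficients `G^i` in the standard coordinates induced by `φ`: the `∂/∂y^i`-component
of the spray is `-2 G^i`. -/
def Spray.coeff (G : Spray n M) (φ : OpenPartialHomeomorph M (EuclideanSpace ℝ (Fin n)))
    (i : Fin n) (p : XY n) : ℝ :=
  -(1 / 2) * (components G.field φ p).2 i

/-- `G` is of isotropic curvature: `R^i_k = R δ^i_k - ½ R_{·k} y^i`, where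
`R = (1/(n-1)) R^m_m`. -/
def Spray.IsIsotropic (G : Spray n M) : Prop :=
  ∀ φ ∈ IsManifold.maximalAtlas (𝓡 n) ∞ M, ∀ p ∈ slit φ, ∀ i k : Fin n,
    tensorT (G.coeff φ) i k p = 0

/-- `F² = R` on nonzero vectors, where `R = (1/(n-1)) R^m_m` is computed from `G`. -/
def Spray.CurvatureIsSqOf (G : Spray n M) (F : FinslerMetric n M) : Prop :=
  ∀ φ ∈ IsManifold.maximalAtlas (𝓡 n) ∞ M, ∀ p ∈ slit φ,
    localSq F.norm φ p = scalR (G.coeff φ) p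

/-- `L = F²` is dually equivalent to `G`: the spray coefficients of `F` are
`G^i + ¼ g^{ik} L_{|k}`, the horizontal derivative being that of `G`. -/
def FinslerMetric.DuallyEquivalent (F : FinslerMetric n M) (G : Spray n M) : Prop :=
  ∀ φ ∈ IsManifold.maximalAtlas (𝓡 n) ∞ M, ∀ p ∈ slit φ, ∀ i : Fin n,
    finslerCoeff (localSq F.norm φ) i p = G.coeff φ i p +
      1 / 4 * ∑ k, (fundTensor (localSq F.norm φ) p)⁻¹ i k *
        hd (G.coeff φ) k (localSq F.norm φ) p

end Curvature

end SprayGeometry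

end

/-! Everything is local, on an open set of pairs `(x, y)` with `y ≠ 0`. The fields `∂/∂y^k` and
`δ/δx^k` have commutators governed by `Γ` and by the curvature `R^i_{kl}` of the nonlinear
connection (`dy_hd`, `hd_hd`). The first Bianchi identity recovers `R^i_{kl}` from `R^i_k`
(`three_mul_curv`), so isotropy forces `R^i_{kl} = ½(R_{·l} δ^i_k - R_{·k} δ^i_l)`
(`curv_of_isotropic`). In dimension at least 3 there is an index `i` distinct from given `k ≠ m`;
the second Bianchi identity for the component `i` and directions `k, i, m` then collapses to
`R_{·m|k} = R_{·k|m}` (`hd_dy_scalR_comm`). Contracting with `y^m` and using `R_{·m} y^m = 2R` gives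
`η = 0`. For `L = R`, the equation `η_l = 0` written out is `L_{x^k y^l} y^k - L_{x^l} = L_{|l} + 4
g_{ls} G^s`; applying `¼ g^{il}` gives the dual equivalence (`finslerCoeff_eq`). -/

noncomputable section

namespace SprayGeometry

variable {n : ℕ}

/-! ### Second derivatives along vector fields -/

section Calculus

variable {E : Type*} [NormedAddCommGroup E] [NormedSpace ℝ E] {f : E → ℝ} {p : E}

theorem fderiv_fderiv_apply (hf : ContDiffAt ℝ ∞ f p) {w : E → E}
    (hw : DifferentiableAt ℝ w p) (v : E) :
    fderiv ℝ (fun q => fderiv ℝ f q (w q)) p v =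
      fderiv ℝ (fderiv ℝ f) p v (w p) + fderiv ℝ f p (fderiv ℝ w p v) := by
  have h1 : DifferentiableAt ℝ (fderiv ℝ f) p :=
    (hf.fderiv_right (m := 1) (by norm_cast)).differentiableAt (by simp)
  rw [(h1.hasFDerivAt.clm_apply hw.hasFDerivAt).fderiv]
  simp [add_comm]

theorem fderiv_fderiv_comm (hf : ContDiffAt ℝ ∞ f p) (v w : E) :
    fderiv ℝ (fderiv ℝ f) p v w = fderiv ℝ (fderiv ℝ f) p w v :=
  (hf.isSymmSndFDerivAt (by simp; norm_cast)).eq v w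

/-- The commutator of the derivatives along two vector fields. -/
theorem fderiv_commutator (hf : ContDiffAt ℝ ∞ f p) {v w : E → E}
    (hv : DifferentiableAt ℝ v p) (hw : DifferentiableAt ℝ w p) :
    fderiv ℝ (fun q => fderiv ℝ f q (w q)) p (v p) -
      fderiv ℝ (fun q => fderiv ℝ f q (v q)) p (w p) =
      fderiv ℝ f p (fderiv ℝ w p (v p) - fderiv ℝ v p (w p)) := by
  rw [fderiv_fderiv_apply hf hw, fderiv_fderiv_apply hf hv, fderiv_fderiv_comm hf, map_sub]
  ring

theorem fderiv_sum_mul {ι : Type*} [Fintype ι] {a b : ι → E → ℝ}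
    (ha : ∀ i, DifferentiableAt ℝ (a i) p) (hb : ∀ i, DifferentiableAt ℝ (b i) p) (v : E) :
    fderiv ℝ (fun q => ∑ i, a i q * b i q) p v =
      ∑ i, (fderiv ℝ (a i) p v * b i p + a i p * fderiv ℝ (b i) p v) := by
  rw [(HasFDerivAt.fun_sum (u := Finset.univ)
    fun i _ => (ha i).hasFDerivAt.fun_mul (hb i).hasFDerivAt).fderiv]
  simp only [sum_apply, add_apply,
    smul_apply, smul_eq_mul]
  exact Finset.sum_congr rfl fun i _ => by ring

theorem fderiv_congr_of_eqOn {S : Set E} (hS : IsOpen S) {g : E → ℝ} (h : Set.EqOn f g S)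
    (hp : p ∈ S) : fderiv ℝ f p = fderiv ℝ g p :=
  (h.eventuallyEq_of_mem (hS.mem_nhds hp)).fderiv_eq

end Calculus

/-- The velocity coordinate `y^j`. -/
def velocity (j : Fin n) : XY n →L[ℝ] ℝ :=
  (EuclideanSpace.proj j).comp (ContinuousLinearMap.snd ℝ _ _)

theorem velocity_apply (j : Fin n) (p : XY n) : velocity j p = p.2 j := rfl

theorem fderiv_velocity (j : Fin n) (p v : XY n) :
    fderiv ℝ (fun q : XY n => q.2 j) p v = v.2 j := by
  rw [show (fun q : XY n => q.2 j) = velocity j from rfl, ContinuousLinearMap.fderiv,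
    velocity_apply]

theorem differentiableAt_velocity (j : Fin n) (p : XY n) :
    DifferentiableAt ℝ (fun q : XY n => q.2 j) p :=
  (velocity j).differentiableAt

theorem contDiffOn_velocity (j : Fin n) (S : Set (XY n)) :
    ContDiffOn ℝ ∞ (fun q : XY n => q.2 j) S :=
  (velocity j).contDiff.contDiffOn

/-! ### The operators `∂/∂y^k` and `δ/δx^k` -/

/-- The coordinate vector field `∂/∂y^k`. -/
def vvec (k : Fin n) : XY n := (0, EuclideanSpace.single k 1)

/-- The horizontal vector field `δ/δx^k`. -/
def hvec (G : Fin n → XY n → ℝ) (k : Fin n) (p : XY n) : XY n :=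
  (EuclideanSpace.single k 1, 0) - ∑ m, connN G m k p • vvec m

theorem dy_eq (k : Fin n) (f : XY n → ℝ) (p : XY n) : dy k f p = fderiv ℝ f p (vvec k) := rfl

theorem hd_eq (G : Fin n → XY n → ℝ) (k : Fin n) (f : XY n → ℝ) (p : XY n) :
    hd G k f p = fderiv ℝ f p (hvec G k p) := by
  simp only [hvec, map_sub, map_sum, map_smul, smul_eq_mul]
  rfl

theorem hvec_snd (G : Fin n → XY n → ℝ) (k j : Fin n) (p : XY n) :
    (hvec G k p).2 j = -connN G j k p := by
  simp [hvec, vvec, Prod.snd_sum, Finset.sum_apply, Pi.single_apply]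

theorem vvec_snd (k j : Fin n) : (vvec k).2 j = if j = k then (1 : ℝ) else 0 := by
  simp [vvec]

/-- Spray coefficients `G^i` on an open set of nonzero vectors, smooth and satisfying Euler's
relation `N^i_j y^j = 2 G^i`. -/
structure IsLocalSpray (S : Set (XY n)) (G : Fin n → XY n → ℝ) : Prop where
  isOpen : IsOpen S
  ne_zero : ∀ p ∈ S, p.2 ≠ 0
  smooth : ∀ i, ContDiffOn ℝ ∞ (G i) S
  euler : ∀ i, ∀ p ∈ S, ∑ j, connN G i j p * p.2 j = 2 * G i p

/-- The curvature `R^i_{kl} = δN^i_l/δx^k - δN^i_k/δx^l` of the nonlinear connection. -/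
def curv (G : Fin n → XY n → ℝ) (i k l : Fin n) (p : XY n) : ℝ :=
  hd G k (connN G i l) p - hd G l (connN G i k) p

theorem curv_swap (G : Fin n → XY n → ℝ) (i k l : Fin n) (p : XY n) :
    curv G i k l p = -curv G i l k p := by
  simp only [curv]; ring

theorem riem4_swap (G : Fin n → XY n → ℝ) (j i k l : Fin n) (p : XY n) :
    riem4 G j i k l p = -riem4 G j i l k p := by
  simp only [riem4, mul_comm]; ring

theorem riem2_of_isotropic {S : Set (XY n)} {G : Fin n → XY n → ℝ}
    (hT : ∀ p ∈ S, ∀ i k, tensorT G i k p = 0) {p : XY n} (hp : p ∈ S) (i k : Fin n) :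
    riem2 G i k p = scalR G p * (if i = k then 1 else 0) - 1 / 2 * dy k (scalR G) p * p.2 i :=
  sub_eq_zero.1 (hT p hp i k)

/-! ### Commutators, curvature and Bianchi identities of a local spray -/

namespace IsLocalSpray

variable {S : Set (XY n)} {G : Fin n → XY n → ℝ} (h : IsLocalSpray S G)
  {f g : XY n → ℝ} {p : XY n}

include h

theorem differentiableAt (hf : ContDiffOn ℝ ∞ f S) (hp : p ∈ S) : DifferentiableAt ℝ f p :=
  (hf.contDiffAt (h.isOpen.mem_nhds hp)).differentiableAt (by simp)

theorem contDiffOn_fderiv_apply (hf : ContDiffOn ℝ ∞ f S) (v : XY n) :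
    ContDiffOn ℝ ∞ (fun p => fderiv ℝ f p v) S :=
  (hf.fderiv_of_isOpen h.isOpen (by simp)).clm_apply contDiffOn_const

theorem contDiffOn_dy (hf : ContDiffOn ℝ ∞ f S) (k : Fin n) : ContDiffOn ℝ ∞ (dy k f) S :=
  h.contDiffOn_fderiv_apply hf _

theorem contDiffOn_dx (hf : ContDiffOn ℝ ∞ f S) (k : Fin n) : ContDiffOn ℝ ∞ (dx k f) S :=
  h.contDiffOn_fderiv_apply hf _

theorem contDiffOn_connN (i j : Fin n) : ContDiffOn ℝ ∞ (connN G i j) S :=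
  h.contDiffOn_dy (h.smooth i) j

theorem contDiffOn_connΓ (i j k : Fin n) : ContDiffOn ℝ ∞ (connΓ G i j k) S :=
  h.contDiffOn_dy (h.contDiffOn_connN i k) j

theorem contDiffOn_hd (hf : ContDiffOn ℝ ∞ f S) (k : Fin n) : ContDiffOn ℝ ∞ (hd G k f) S :=
  (h.contDiffOn_dx hf k).sub <| ContDiffOn.sum fun m _ =>
    (h.contDiffOn_connN m k).mul (h.contDiffOn_dy hf m)

theorem contDiffOn_curv (i k l : Fin n) : ContDiffOn ℝ ∞ (curv G i k l) S :=
  (h.contDiffOn_hd (h.contDiffOn_connN i l) k).sub (h.contDiffOn_hd (h.contDiffOn_connN i k) l)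

theorem dy_congr (hfg : Set.EqOn f g S) (hp : p ∈ S) (k : Fin n) : dy k f p = dy k g p := by
  simp only [dy, fderiv_congr_of_eqOn h.isOpen hfg hp]

theorem hd_congr (hfg : Set.EqOn f g S) (hp : p ∈ S) (k : Fin n) :
    hd G k f p = hd G k g p := by
  simp only [hd_eq, fderiv_congr_of_eqOn h.isOpen hfg hp]

theorem dy_comm (hf : ContDiffOn ℝ ∞ f S) (hp : p ∈ S) (j k : Fin n) :
    dy j (dy k f) p = dy k (dy j f) p := by
  have := fderiv_commutator (hf.contDiffAt (h.isOpen.mem_nhds hp))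
    (differentiableAt_const (vvec j)) (differentiableAt_const (vvec k))
  rw [fderiv_const_apply, fderiv_const_apply] at this
  simp only [zero_apply, sub_zero, map_zero, sub_eq_zero] at this
  exact this

theorem connΓ_comm (hp : p ∈ S) (i j k : Fin n) : connΓ G i j k p = connΓ G i k j p :=
  h.dy_comm (h.smooth i) hp j k

theorem differentiableAt_hvec (hp : p ∈ S) (k : Fin n) : DifferentiableAt ℝ (hvec G k) p :=
  (differentiableAt_const _).sub <| DifferentiableAt.fun_sum fun m _ =>
    (h.differentiableAt (h.contDiffOn_connN m k) hp).smul_const _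

theorem fderiv_hvec (hp : p ∈ S) (k : Fin n) (v : XY n) :
    fderiv ℝ (hvec G k) p v = -∑ m, fderiv ℝ (connN G m k) p v • vvec m := by
  have := ((hasFDerivAt_const ((EuclideanSpace.single k 1, 0) : XY n) p).sub
    (HasFDerivAt.fun_sum (u := Finset.univ) fun m _ =>
      (h.differentiableAt (h.contDiffOn_connN m k) hp).hasFDerivAt.smul_const (vvec m))).fderiv
  rw [show hvec G k = _ from rfl]
  erw [this]
  simp

/-- `[∂/∂y^m, δ/δx^k] = -Γ^j_{mk} ∂/∂y^j`. -/
theorem dy_hd (hf : ContDiffOn ℝ ∞ f S) (hp : p ∈ S) (m k : Fin n) :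
    dy m (hd G k f) p = hd G k (dy m f) p - ∑ j, connΓ G j m k p * dy j f p := by
  have := fderiv_commutator (hf.contDiffAt (h.isOpen.mem_nhds hp))
    (differentiableAt_const (vvec m)) (h.differentiableAt_hvec hp k)
  rw [fderiv_const_apply, h.fderiv_hvec hp] at this
  simp only [zero_apply, sub_zero, map_neg, map_sum, map_smul,
    smul_eq_mul, ← hd_eq, ← dy_eq] at this
  simp only [connΓ, ← connN.eq_1]
  change dy m (hd G k f) p - hd G k (dy m f) p = _ at this
  change _ = hd G k (dy m f) p - ∑ j, dy m (connN G j k) p * _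
  linarith

/-- `[δ/δx^k, δ/δx^l] = -R^j_{kl} ∂/∂y^j`. -/
theorem hd_hd (hf : ContDiffOn ℝ ∞ f S) (hp : p ∈ S) (k l : Fin n) :
    hd G k (hd G l f) p - hd G l (hd G k f) p = -∑ j, curv G j k l p * dy j f p := by
  have e : ∀ k, (fun q => fderiv ℝ f q (hvec G k q)) = hd G k f :=
    fun k => funext fun q => (hd_eq G k f q).symm
  have := fderiv_commutator (hf.contDiffAt (h.isOpen.mem_nhds hp))
    (h.differentiableAt_hvec hp k) (h.differentiableAt_hvec hp l)
  rw [h.fderiv_hvec hp, h.fderiv_hvec hp, e, e] at this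
  simp only [map_sub, map_neg, map_sum, map_smul, smul_eq_mul, ← hd_eq, ← dy_eq] at this
  simp only [curv, sub_mul, Finset.sum_sub_distrib]
  linarith

/-- The Leibniz rule for contractions with the velocity. -/
theorem fderiv_contract {a : Fin n → XY n → ℝ} (ha : ∀ j, ContDiffOn ℝ ∞ (a j) S) (hp : p ∈ S)
    (v : XY n) : fderiv ℝ (fun q => ∑ j, a j q * q.2 j) p v =
      ∑ j, fderiv ℝ (a j) p v * p.2 j + ∑ j, a j p * v.2 j := by
  rw [fderiv_sum_mul (fun j => h.differentiableAt (ha j) hp)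
    (fun j => differentiableAt_velocity j p), Finset.sum_add_distrib]
  simp only [fderiv_velocity]

theorem dy_contract {a : Fin n → XY n → ℝ} (ha : ∀ j, ContDiffOn ℝ ∞ (a j) S) (hp : p ∈ S)
    (k : Fin n) : dy k (fun q => ∑ j, a j q * q.2 j) p = ∑ j, dy k (a j) p * p.2 j + a k p := by
  rw [dy_eq, h.fderiv_contract ha hp]
  simp [dy_eq, vvec_snd]

/-- The correction term comes from `δy^j/δx^k = -N^j_k`; in covariant derivatives it is compensated
by the `Γ` term, since `Γ^j_{kl} y^l = N^j_k`. -/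
theorem hd_contract {a : Fin n → XY n → ℝ} (ha : ∀ j, ContDiffOn ℝ ∞ (a j) S) (hp : p ∈ S)
    (k : Fin n) : hd G k (fun q => ∑ j, a j q * q.2 j) p =
      ∑ j, hd G k (a j) p * p.2 j - ∑ j, a j p * connN G j k p := by
  rw [hd_eq, h.fderiv_contract ha hp]
  simp [hd_eq, hvec_snd, sub_eq_add_neg]

/-- `Γ^i_{kj} y^j = N^i_k`. -/
theorem connΓ_contract (hp : p ∈ S) (i k : Fin n) :
    ∑ j, connΓ G i k j p * p.2 j = connN G i k p := by
  -- Differentiate Euler's relation `N^i_j y^j = 2G^i` along `y^k`.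
  have h1 := h.dy_congr (f := fun q => ∑ j, connN G i j q * q.2 j) (g := fun q => 2 * G i q)
    (h.euler i) hp k
  rw [h.dy_contract (h.contDiffOn_connN i) hp, dy,
    fderiv_const_mul (h.differentiableAt (h.smooth i) hp)] at h1
  change ∑ j, connΓ G i k j p * p.2 j + connN G i k p = 2 * connN G i k p at h1
  linarith

/-- `R_m^i_{kl} = ∂R^i_{kl}/∂y^m`. -/
theorem dy_curv (hp : p ∈ S) (m i k l : Fin n) : dy m (curv G i k l) p = riem4 G m i k l p := by
  have hd' := fun k l => h.differentiableAt (h.contDiffOn_hd (h.contDiffOn_connN i l) k) hp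
  have e : dy m (curv G i k l) p =
      dy m (hd G k (connN G i l)) p - dy m (hd G l (connN G i k)) p := by
    simp only [dy]
    rw [show curv G i k l = hd G k (connN G i l) - hd G l (connN G i k) from rfl,
      fderiv_sub (hd' k l) (hd' l k)]
    rfl
  rw [e, h.dy_hd (h.contDiffOn_connN i l) hp, h.dy_hd (h.contDiffOn_connN i k) hp, riem4]
  have e1 : ∑ s, connΓ G i k s p * connΓ G s m l p = ∑ j, connΓ G j m l p * connΓ G i j k p :=
    Finset.sum_congr rfl fun s _ => by rw [h.connΓ_comm hp i k s, mul_comm]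
  have e2 : ∑ s, connΓ G s m k p * connΓ G i l s p = ∑ j, connΓ G j m k p * connΓ G i j l p :=
    Finset.sum_congr rfl fun s _ => by rw [h.connΓ_comm hp i l s]
  rw [e1, e2]
  simp only [connΓ, ← connN.eq_1]
  ring

/-- The first Bianchi identity. -/
theorem riem4_cyclic (hp : p ∈ S) (i k l m : Fin n) :
    riem4 G m i k l p + riem4 G k i l m p + riem4 G l i m k p = 0 := by
  have c : ∀ a b c, hd G c (connΓ G i a b) p = hd G c (connΓ G i b a) p := fun a b c =>
    h.hd_congr (fun q hq => h.connΓ_comm hq i a b) hp c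
  have d : ∀ a b c, ∑ s, connΓ G i c s p * connΓ G s a b p =
      ∑ s, connΓ G s b a p * connΓ G i c s p := fun a b c =>
    Finset.sum_congr rfl fun s _ => by rw [h.connΓ_comm hp s a b, mul_comm]
  -- Symmetry of `Γ` in its lower indices makes the derivative terms and the quadratic terms cancel
  -- in pairs.
  simp only [riem4]
  rw [c m l k, c m k l, c k l m, d m l k, d k m l, d l k m]
  ring

/-- Moving `y^j` inside `δ/δx^k` costs `Γ^i_{lj} N^j_k`, and these corrections cancel exactly the
contracted quadratic terms. -/
theorem riem4_contract (hp : p ∈ S) (i k l : Fin n) :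
    ∑ j, riem4 G j i k l p * p.2 j = curv G i k l p := by
  have c : ∀ k l, ∑ j, hd G k (connΓ G i j l) p * p.2 j =
      hd G k (connN G i l) p + ∑ j, connΓ G i l j p * connN G j k p := fun k l => by
    have h1 := h.hd_congr (f := fun q => ∑ j, connΓ G i l j q * q.2 j)
      (fun q hq => h.connΓ_contract hq i l) hp k
    rw [h.hd_contract (h.contDiffOn_connΓ i l) hp] at h1
    rw [← h1, sub_add_cancel]
    exact Finset.sum_congr rfl fun j _ => by
      rw [h.hd_congr (fun q hq => h.connΓ_comm hq i j l) hp]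
  have d : ∀ k l, ∑ j, (∑ s, connΓ G i k s p * connΓ G s j l p) * p.2 j =
      ∑ s, connΓ G i k s p * connN G s l p := fun k l => by
    simp only [Finset.sum_mul]
    rw [Finset.sum_comm]
    refine Finset.sum_congr rfl fun s _ => ?_
    rw [← h.connΓ_contract hp s l, Finset.mul_sum]
    exact Finset.sum_congr rfl fun j _ => by rw [h.connΓ_comm hp s j l]; ring
  have d' : ∑ j, (∑ s, connΓ G s j k p * connΓ G i l s p) * p.2 j =
      ∑ s, connΓ G i l s p * connN G s k p := by
    rw [← d]
    simp only [mul_comm]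
  simp only [riem4, sub_mul, add_mul, Finset.sum_sub_distrib, Finset.sum_add_distrib]
  rw [c, c, d, d', curv]
  ring

theorem riem2_eq (hp : p ∈ S) (i k : Fin n) :
    riem2 G i k p = ∑ l, curv G i k l p * p.2 l := by
  rw [riem2, Finset.sum_comm]
  refine Finset.sum_congr rfl fun l _ => ?_
  rw [← h.riem4_contract hp, Finset.sum_mul]
  exact Finset.sum_congr rfl fun j _ => by ring

theorem contDiffOn_riem2 (i k : Fin n) : ContDiffOn ℝ ∞ (riem2 G i k) S :=
  ContDiffOn.congr (ContDiffOn.sum fun l _ => (h.contDiffOn_curv i k l).mul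
    (contDiffOn_velocity l S)) fun _ hq => h.riem2_eq hq i k

theorem contDiffOn_scalR : ContDiffOn ℝ ∞ (scalR G) S :=
  contDiffOn_const.mul (ContDiffOn.sum fun m _ => h.contDiffOn_riem2 m m)

/-- `R^i_k y^k = 0`. -/
theorem riem2_contract (hp : p ∈ S) (i : Fin n) : ∑ k, riem2 G i k p * p.2 k = 0 := by
  have e : ∑ k, riem2 G i k p * p.2 k = ∑ k, ∑ l, curv G i k l p * p.2 l * p.2 k :=
    Finset.sum_congr rfl fun k _ => by rw [h.riem2_eq hp, Finset.sum_mul]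
  have e' : ∑ k, ∑ l, curv G i k l p * p.2 l * p.2 k =
      -∑ k, ∑ l, curv G i k l p * p.2 l * p.2 k := by
    conv_lhs => rw [Finset.sum_comm]
    simp only [← Finset.sum_neg_distrib]
    exact Finset.sum_congr rfl fun k _ => Finset.sum_congr rfl fun l _ => by
      rw [curv_swap]; ring
  rw [e]; linarith

/-- `3 R^i_{kl} = R^i_{k·l} - R^i_{l·k}`. -/
theorem three_mul_curv (hp : p ∈ S) (i k l : Fin n) :
    3 * curv G i k l p = dy l (riem2 G i k) p - dy k (riem2 G i l) p := by
  -- Each product rule contributes one copy of `R^i_{kl}` by differentiating `y`; the third copy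
  -- comes from the first Bianchi identity in `s`.
  have d : ∀ k l, dy l (riem2 G i k) p = ∑ m, riem4 G l i k m p * p.2 m + curv G i k l p :=
    fun k l => by
      rw [h.dy_congr (fun q hq => h.riem2_eq hq i k) hp, h.dy_contract (h.contDiffOn_curv i k) hp]
      simp only [h.dy_curv hp]
  have s : ∑ m, riem4 G l i k m p * p.2 m - ∑ m, riem4 G k i l m p * p.2 m =
      curv G i k l p := by
    rw [← h.riem4_contract hp, ← Finset.sum_sub_distrib]
    refine Finset.sum_congr rfl fun m _ => ?_
    have h1 := h.riem4_cyclic hp i k l m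
    rw [riem4_swap G l i m k] at h1
    linear_combination (-p.2 m) * h1
  rw [d, d, curv_swap G i l k]
  linarith

/-- The second Bianchi identity. -/
theorem hd_curv_cyclic (hp : p ∈ S) (i k l m : Fin n) :
    hd G k (curv G i l m) p + hd G l (curv G i m k) p + hd G m (curv G i k l) p +
      ∑ j, (curv G j k l p * connΓ G i j m p + curv G j l m p * connΓ G i j k p +
        curv G j m k p * connΓ G i j l p) = 0 := by
  have e : ∀ k l m, hd G k (curv G i l m) p =
      hd G k (hd G l (connN G i m)) p - hd G k (hd G m (connN G i l)) p := fun k l m => by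
    simp only [hd_eq G k]
    rw [show curv G i l m = hd G l (connN G i m) - hd G m (connN G i l) from rfl,
      fderiv_sub (h.differentiableAt (h.contDiffOn_hd (h.contDiffOn_connN i m) l) hp)
        (h.differentiableAt (h.contDiffOn_hd (h.contDiffOn_connN i l) m) hp)]
    rfl
  -- The six iterated derivatives of `N` pair up into three commutators.
  have c : ∀ k l m, hd G k (hd G l (connN G i m)) p - hd G l (hd G k (connN G i m)) p =
      -∑ j, curv G j k l p * connΓ G i j m p := fun k l m =>
    h.hd_hd (h.contDiffOn_connN i m) hp k l
  rw [e, e, e, Finset.sum_add_distrib, Finset.sum_add_distrib]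
  linear_combination c k l m + c l m k + c m k l

/-! ### Isotropic curvature -/

section Isotropic

variable (hT : ∀ p ∈ S, ∀ i k, tensorT G i k p = 0)

include hT

/-- `R_{·k} y^k = 2R`. -/
theorem dy_scalR_contract (hp : p ∈ S) : ∑ k, dy k (scalR G) p * p.2 k = 2 * scalR G p := by
  -- Contracting the isotropy formula with `y^k` gives `y^i (R - ½ R_{·k} y^k) = 0`, so one nonzero
  -- component of `y` suffices.
  obtain ⟨i, hi⟩ : ∃ i, p.2 i ≠ 0 := by
    by_contra! H
    exact h.ne_zero p hp (by ext i; exact H i)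
  have h1 := h.riem2_contract hp i
  simp only [riem2_of_isotropic hT hp, sub_mul, Finset.sum_sub_distrib, mul_ite, mul_one,
    mul_zero, ite_mul, zero_mul, Finset.sum_ite_eq, Finset.mem_univ, if_true] at h1
  have h2 : ∑ k, 1 / 2 * dy k (scalR G) p * p.2 i * p.2 k =
      1 / 2 * p.2 i * ∑ k, dy k (scalR G) p * p.2 k := by
    rw [Finset.mul_sum]
    exact Finset.sum_congr rfl fun k _ => by ring
  rw [h2] at h1
  apply mul_left_cancel₀ hi
  linarith

/-- Antisymmetrizing the derivative of the isotropy formula kills the Hessian term `R_{·k·l} y^i`;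
the Kronecker terms add up to `3/2`, and `three_mul_curv` removes the 3. -/
theorem curv_of_isotropic (hp : p ∈ S) (i k l : Fin n) :
    curv G i k l p = 1 / 2 * (dy l (scalR G) p * (if i = k then 1 else 0) -
      dy k (scalR G) p * (if i = l then 1 else 0)) := by
  have hR := h.contDiffOn_scalR
  have d : ∀ k l, dy l (riem2 G i k) p = dy l (scalR G) p * (if i = k then 1 else 0) -
      1 / 2 * (dy l (dy k (scalR G)) p * p.2 i +
        dy k (scalR G) p * (if i = l then 1 else 0)) := fun k l => by
    rw [h.dy_congr (fun q hq => riem2_of_isotropic hT hq i k) hp, dy_eq]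
    have h1 := (h.differentiableAt hR hp).hasFDerivAt.mul_const (if i = k then (1 : ℝ) else 0)
    have h2 := ((h.differentiableAt (h.contDiffOn_dy hR k) hp).hasFDerivAt.const_mul
      (1 / 2)).fun_mul (differentiableAt_velocity i p).hasFDerivAt
    rw [(h1.fun_sub h2).fderiv]
    simp only [sub_apply, add_apply, smul_apply, fderiv_velocity, vvec_snd, smul_eq_mul]
    simp only [← dy_eq]
    ring
  have h3 := h.three_mul_curv hp i k l
  rw [d, d, h.dy_comm hR hp k l] at h3
  linarith

/-- `δR_{·m}/δx^k = δR_{·k}/δx^m`, which is equivalent to `R_{·m|k} = R_{·k|m}`. -/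
theorem hd_dy_scalR_comm (hn : 3 ≤ n) (hp : p ∈ S) (k m : Fin n) :
    hd G k (dy m (scalR G)) p = hd G m (dy k (scalR G)) p := by
  rcases eq_or_ne k m with rfl | hkm
  · rfl
  obtain ⟨i, hi⟩ : ∃ i : Fin n, i ∉ ({k, m} : Finset (Fin n)) := by
    by_contra! H
    have h1 : (Finset.univ : Finset (Fin n)).card ≤ ({k, m} : Finset (Fin n)).card :=
      Finset.card_le_card fun i _ => H i
    have h2 := Finset.card_le_two (a := k) (b := m)
    rw [Finset.card_univ, Fintype.card_fin] at h1
    omega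
  obtain ⟨hik, him⟩ : i ≠ k ∧ i ≠ m := by simpa using hi
  have hR := h.contDiffOn_scalR
  have e : ∀ a b c, hd G c (curv G i a b) p =
      1 / 2 * (hd G c (dy b (scalR G)) p * (if i = a then 1 else 0) -
        hd G c (dy a (scalR G)) p * (if i = b then 1 else 0)) := fun a b c => by
    rw [h.hd_congr (fun q hq => h.curv_of_isotropic hT hq i a b) hp, hd_eq]
    have h1 := fun a => (h.differentiableAt (h.contDiffOn_dy hR a) hp).hasFDerivAt
    rw [((((h1 b).mul_const (if i = a then (1 : ℝ) else 0)).fun_sub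
      ((h1 a).mul_const (if i = b then (1 : ℝ) else 0))).const_mul (1 / 2)).fderiv]
    simp only [sub_apply, smul_apply, ← hd_eq, smul_eq_mul]
    ring
  -- No summation over `i`: with `i ≠ k, m` only two derivative terms survive, and the `Γ` terms
  -- cancel by symmetry.
  have B := h.hd_curv_cyclic hp i k i m
  rw [e, e, e] at B
  simp only [h.curv_of_isotropic hT hp, Finset.sum_add_distrib, mul_ite, mul_one, mul_zero,
    mul_sub, sub_mul, ite_mul, zero_mul, Finset.sum_sub_distrib, Finset.sum_ite_eq',
    Finset.mem_univ, if_true, if_neg hik, if_neg him] at B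
  rw [h.connΓ_comm hp i k i, h.connΓ_comm hp i k m, h.connΓ_comm hp i i m] at B
  linarith

/-- `η_l = 0`. -/
theorem etaForm_eq_zero (hn : 3 ≤ n) (hp : p ∈ S) (l : Fin n) : etaForm G l p = 0 := by
  have hR := h.contDiffOn_scalR
  have h1 := h.hd_congr (fun q hq => h.dy_scalR_contract hT hq) hp l
  rw [h.hd_contract (fun k => h.contDiffOn_dy hR k) hp] at h1
  have h2 : hd G l (fun q => 2 * scalR G q) p = 2 * hd G l (scalR G) p := by
    rw [hd_eq, fderiv_const_mul (h.differentiableAt hR hp), hd_eq]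
    simp
  have h3 : ∑ m, (∑ s, connΓ G s l m p * dy s (scalR G) p) * p.2 m =
      ∑ s, dy s (scalR G) p * connN G s l p := by
    simp only [Finset.sum_mul]
    rw [Finset.sum_comm]
    refine Finset.sum_congr rfl fun s _ => ?_
    rw [← h.connΓ_contract hp s l, Finset.mul_sum]
    exact Finset.sum_congr rfl fun m _ => by ring
  simp only [etaForm, hdCovector, sub_mul, Finset.sum_sub_distrib]
  -- The symmetry lets the derivative in direction `l` fall on `R_{·m}`, so that `h1`, the
  -- derivative of `R_{·m} y^m = 2R`, applies.
  simp only [h.hd_dy_scalR_comm hT hn hp _ l]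
  rw [h3, h1, h2]
  ring

end Isotropic

/-- If `η = 0` then the spray coefficients of `L = R` are `G^i + ¼ g^{ik} L_{|k}`. -/
theorem finslerCoeff_eq {L : XY n → ℝ} (hL : Set.EqOn L (scalR G) S) (hp : p ∈ S)
    (hη : ∀ l, etaForm G l p = 0) (hg : IsUnit (fundTensor L p).det) (i : Fin n) :
    finslerCoeff L i p = G i p + 1 / 4 * ∑ k, (fundTensor L p)⁻¹ i k * hd G k L p := by
  have hLs : ContDiffOn ℝ ∞ L S := h.contDiffOn_scalR.congr hL
  have hdyL : ∀ l, Set.EqOn (dy l L) (dy l (scalR G)) S := fun l q hq => h.dy_congr hL hq l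
  have key : ∀ l, ∑ k, dx k (dy l L) p * p.2 k - dx l L p =
      hd G l L p + 4 * ∑ s, fundTensor L p l s * G s p := fun l => by
    have h1 := hη l
    simp only [etaForm, hdCovector] at h1
    rw [← h.hd_congr hL hp] at h1
    simp only [← h.hd_congr (hdyL _) hp, ← hdyL _ hp] at h1
    have h3 : ∑ m, (∑ s, connΓ G s l m p * dy s L p) * p.2 m =
        ∑ s, connN G s l p * dy s L p := by
      simp only [Finset.sum_mul]
      rw [Finset.sum_comm]
      refine Finset.sum_congr rfl fun s _ => ?_
      rw [← h.connΓ_contract hp s l, Finset.sum_mul]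
      exact Finset.sum_congr rfl fun m _ => by ring
    have h4 : ∑ m, hd G m (dy l L) p * p.2 m =
        ∑ m, dx m (dy l L) p * p.2 m - 4 * ∑ s, fundTensor L p l s * G s p := by
      simp only [hd, sub_mul, Finset.sum_sub_distrib, Finset.sum_mul]
      rw [Finset.sum_comm, Finset.mul_sum]
      congr 1
      refine Finset.sum_congr rfl fun s _ => ?_
      have e : ∑ m, connN G s m p * dy s (dy l L) p * p.2 m =
          dy s (dy l L) p * ∑ m, connN G s m p * p.2 m := by
        rw [Finset.mul_sum]
        exact Finset.sum_congr rfl fun m _ => by ring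
      -- The factor 4 arises from `N^s_m y^m = 2G^s` and `L_{·l·s} = 2g_{ls}`.
      rw [e, h.euler s p hp, h.dy_comm hLs hp s l]
      simp only [fundTensor, Matrix.of_apply]
      ring
    simp only [sub_mul, Finset.sum_sub_distrib] at h1
    rw [h3, h4] at h1
    have h5 : hd G l L p = dx l L p - ∑ s, connN G s l p * dy s L p := rfl
    linarith
  have hinv : ∑ l, (fundTensor L p)⁻¹ i l * ∑ s, fundTensor L p l s * G s p = G i p := by
    have := congrFun (Matrix.mulVec_mulVec (fun s => G s p) (fundTensor L p)⁻¹ (fundTensor L p)) i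
    rw [Matrix.nonsing_inv_mul _ hg, Matrix.one_mulVec] at this
    exact this
  have e : ∑ l, (fundTensor L p)⁻¹ i l * (4 * ∑ s, fundTensor L p l s * G s p) = 4 * G i p := by
    rw [← hinv, Finset.mul_sum]
    exact Finset.sum_congr rfl fun l _ => by ring
  simp only [finslerCoeff, key, mul_add, Finset.sum_add_distrib]
  rw [e]
  ring

end IsLocalSpray

/-! ### Sprays on manifolds -/

section Manifold

variable {M : Type*} [TopologicalSpace M]

theorem isOpen_slit (φ : OpenPartialHomeomorph M (EuclideanSpace ℝ (Fin n))) :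
    IsOpen (slit φ) :=
  (φ.open_target.preimage continuous_fst).inter (isOpen_ne.preimage continuous_snd)

/-- Euler's relation for functions positively homogeneous of degree two in the velocity. -/
theorem sum_dy_mul_of_homogeneous {f : XY n → ℝ} {p : XY n} (hf : DifferentiableAt ℝ f p)
    (hom : ∀ c : ℝ, 0 < c → f (p.1, c • p.2) = c ^ 2 * f p) :
    ∑ j, dy j f p * p.2 j = 2 * f p := by
  have e : ∑ j, dy j f p * p.2 j = fderiv ℝ f p (0, p.2) := by
    have : ((0, p.2) : XY n) = ∑ j, p.2 j • vvec j := by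
      ext i <;> simp [vvec, Prod.fst_sum, Prod.snd_sum, Pi.single_apply]
    rw [this, map_sum]
    exact Finset.sum_congr rfl fun j _ => by rw [map_smul, smul_eq_mul, mul_comm, dy_eq]
  -- Differentiate `f` along the ray `c ↦ (x, c y)` at `c = 1` in two ways.
  have hγ : HasDerivAt (fun c : ℝ => ((p.1, c • p.2) : XY n)) (0, p.2) 1 := by
    simpa using (hasDerivAt_const (1 : ℝ) p.1).prodMk ((hasDerivAt_id (1 : ℝ)).smul_const p.2)
  have hf' : HasFDerivAt f (fderiv ℝ f p) (p.1, (1 : ℝ) • p.2) := by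
    simpa using hf.hasFDerivAt
  have h1 : HasDerivAt (fun c : ℝ => f (p.1, c • p.2)) (fderiv ℝ f p (0, p.2)) 1 :=
    hf'.comp_hasDerivAt (1 : ℝ) hγ
  have h2 : HasDerivAt (fun c : ℝ => c ^ 2 * f p) (2 * f p) 1 := by
    simpa using (hasDerivAt_pow 2 (1 : ℝ)).mul_const (f p)
  have h3 : (fun c : ℝ => f (p.1, c • p.2)) =ᶠ[nhds 1] fun c => c ^ 2 * f p :=
    (lt_mem_nhds one_pos).mono fun c hc => hom c hc
  rw [e]
  exact (h2.congr_of_eventuallyEq h3).unique h1 |>.symm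

variable [ChartedSpace (EuclideanSpace ℝ (Fin n)) M] [IsManifold (𝓡 n) ∞ M]

theorem Spray.isLocalSpray (G : Spray n M)
    {φ : OpenPartialHomeomorph M (EuclideanSpace ℝ (Fin n))}
    (hφ : φ ∈ IsManifold.maximalAtlas (𝓡 n) ∞ M) : IsLocalSpray (slit φ) (G.coeff φ) := by
  have hs : ∀ i, ContDiffOn ℝ ∞ (G.coeff φ i) (slit φ) := fun i =>
    contDiffOn_const.mul ((EuclideanSpace.proj (𝕜 := ℝ) i).contDiff.comp_contDiffOn
      (G.smooth φ hφ))
  refine ⟨isOpen_slit φ, fun p hp => hp.2, hs, fun i p hp => ?_⟩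
  refine sum_dy_mul_of_homogeneous
    (((hs i).contDiffAt ((isOpen_slit φ).mem_nhds hp)).differentiableAt (by simp)) fun c hc => ?_
  simp only [Spray.coeff, G.homogeneous φ hφ p.1 hp.1 p.2 c hc, PiLp.smul_apply, smul_eq_mul]
  ring

end Manifold
end SprayGeometry
end

theorem mainTheorem4 (n : ℕ) (hn : 3 ≤ n) (M : Type*) [TopologicalSpace M]
    [ChartedSpace (EuclideanSpace ℝ (Fin n)) M] [IsManifold (𝓡 n) ∞ M]
    (G : SprayGeometry.Spray n M) (hG : G.IsIsotropic) :
    (∀ φ ∈ IsManifold.maximalAtlas (𝓡 n) ∞ M, ∀ p ∈ SprayGeometry.slit φ, ∀ l : Fin n,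
      SprayGeometry.etaForm (G.coeff φ) l p = 0) ∧
    (∀ F : SprayGeometry.FinslerMetric n M, G.CurvatureIsSqOf F → F.DuallyEquivalent G) := by
  have hη : ∀ φ ∈ IsManifold.maximalAtlas (𝓡 n) ∞ M, ∀ p ∈ SprayGeometry.slit φ, ∀ l : Fin n,
      SprayGeometry.etaForm (G.coeff φ) l p = 0 := fun φ hφ p hp l =>
    (G.isLocalSpray hφ).etaForm_eq_zero (hG φ hφ) hn hp l
  exact ⟨hη, fun F hF φ hφ p hp i => (G.isLocalSpray hφ).finslerCoeff_eq (hF φ hφ) hp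
    (hη φ hφ p hp) (F.posDef φ hφ p hp).det_pos.ne'.isUnit i⟩
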